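/- Let $V=\{1,\dots,m\}$ be a set of agents. For each $i\in V$ let $I_i$ be a finite index set, let $\mathcal X_i^j\subseteq\mathbb R^d$ ($j\in I_i$) be closed convex sets and let $f_i:\mathbb R^d\to\mathbb R$ be convex and differentiable. Put $\mathcal X_i=\bigcap_{j\in I_i}\mathcal X_i^j$, $\mathcal X=\bigcap_{i\in V}\mathcal X_i$, $f=\sum_{i=1}^m f_i$, and let $\mathcal X^*$ be the set of minimizers of $f$ over $\mathcal X$. Write $\Pi_S$ for the Euclidean projection on a closed convex set $S$ and $\mathrm{dist}(x,S)$ for the Euclidean distance. Assume: 1. There are constants $L$ and $G_f$ with $\|\nabla f_i(x)-\nabla f_i(y)\|\le L\|x-y\|$ for all $x,y\in\mathbb R^d$, $i\in V$, and $\|\nabla f_i(x)\|\le G_f$ for all $x\in\mathcal X$, $i\in V$. 2. The random indices $\Omega_i(k)\in I_i$ ($i\in V$, $k\ge0$) are such that the vectors $(\Omega_i(k))_{i\in V}$, $k\ge 0$, are independent over time, for each $i$ the variables $\Omega_i(k)$, $k\ge0$, are identically distributed, the whole family $(\Omega_i(k))_{i,k}$ is independent of the random initial points $(x_i(0))_{i\in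 V}$ in $\mathbb R^d$, and $\Pr\{\Omega_i(k)=j\}>0$ for all $j\in I_i$, $i\in V$. 3. For every $i\in V$ there is a constant $c>0$ such that, for all $x\in\mathbb R^d$ (and all $k\ge 0$), $\mathrm{dist}^2(x,\mathcal X)\le c\,\mathsf E\big[\mathrm{dist}^2(x,\mathcal X_i^{\Omega_i(k)})\big]$. 4. At each time $k\ge0$ a directed graph $(V,E(k))$ is given with $(i,i)\in E(k)$ for all $i\in V$, and there is an integer $Q$ such that $\big(V,\bigcup_{\ell=0}^{Q-1}E(k+\ell)\big)$ is strongly connected for all $k\ge0$. 5. For each $k\ge0$ the matrix $W(k)\in\mathbb R^{m\times m}$ has nonnegative entries, all its row sums and column sums equal $1$, and $[W(k)]_{ij}=0$ whenever $(i,j)\notin E(k)$; there is $\eta\in(0,1)$, not depending on $k$, such that $[W(k)]_{ij}\ge\eta$ whenever $(i,j)\in E(k)$. 6. The stepsizes are deterministic with $\alpha_k>0$, $\sum_{k=0}^\infty\alpha_k=\infty$ and $\sum_{k=0}^\infty\alpha_k^2<\infty$. 7. $\mathcal X^*\neq\emptyset$. Let the iterates be generated, for $k\ge0$ and $i\in V$,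 by $$v_i(k)=\sum_{j=1}^m[W(k)]_{ij}\,x_j(k),\qquad x_i(k+1)=\Pi_{\mathcal X_i^{\Omega_i(k)}}\big[v_i(k)-\alpha_k\nabla f_i(v_i(k))\big].$$ Then there is a random vector $x^\star$ with values in $\mathcal X^*$ such that, almost surely, $\lim_{k\to\infty}x_i(k)=x^\star$ for all $i\in V$. -/

import Mathlib

open MeasureTheory ProbabilityTheory Filter Topology

/-- The Euclidean projection `Π_S[y]`: a point of `S` that minimizes the distance to `y` among all
points of `S`. For closed convex nonempty `S` it exists and is unique (see `proj_mem`,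
`proj_minimal`, `proj_unique`); if there is no minimizer, the value is the junk value `y`. -/
noncomputable def proj {d : ℕ} (S : Set (EuclideanSpace ℝ (Fin d)))
    (y : EuclideanSpace ℝ (Fin d)) : EuclideanSpace ℝ (Fin d) :=
  open Classical in
  if h : ∃ p ∈ S, ∀ v ∈ S, ‖p - y‖ ≤ ‖v - y‖ then h.choose else y

theorem proj_exists {d : ℕ} {S : Set (EuclideanSpace ℝ (Fin d))} (hne : S.Nonempty)
    (hc : IsClosed S) (y : EuclideanSpace ℝ (Fin d)) :
    ∃ p ∈ S, ∀ v ∈ S, ‖p - y‖ ≤ ‖v - y‖ := by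
  obtain ⟨p, hp, h⟩ := hc.exists_infDist_eq_dist hne y
  refine ⟨p, hp, fun v hv => ?_⟩
  have := Metric.infDist_le_dist_of_mem (x := y) hv
  rw [h] at this
  rwa [← dist_eq_norm, ← dist_eq_norm, dist_comm p, dist_comm v]

theorem proj_mem {d : ℕ} {S : Set (EuclideanSpace ℝ (Fin d))} (hne : S.Nonempty)
    (hc : IsClosed S) (y : EuclideanSpace ℝ (Fin d)) : proj S y ∈ S := by
  rw [proj, dif_pos (proj_exists hne hc y)]
  exact (proj_exists hne hc y).choose_spec.1

theorem proj_minimal {d : ℕ} {S : Set (EuclideanSpace ℝ (Fin d))} (hne : S.Nonempty)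
    (hc : IsClosed S) (y : EuclideanSpace ℝ (Fin d)) :
    ∀ v ∈ S, ‖proj S y - y‖ ≤ ‖v - y‖ := by
  rw [proj, dif_pos (proj_exists hne hc y)]
  exact (proj_exists hne hc y).choose_spec.2

theorem proj_unique {d : ℕ} {S : Set (EuclideanSpace ℝ (Fin d))}
    (hc : IsClosed S) (hconv : Convex ℝ S) (y : EuclideanSpace ℝ (Fin d))
    {p : EuclideanSpace ℝ (Fin d)} (hp : p ∈ S) (hmin : ∀ v ∈ S, ‖p - y‖ ≤ ‖v - y‖) :
    proj S y = p := by
  have hq := proj_mem ⟨p, hp⟩ hc y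
  have hqmin := proj_minimal ⟨p, hp⟩ hc y
  set q := proj S y
  have heq : ‖q - y‖ = ‖p - y‖ := le_antisymm (hqmin p hp) (hmin q hq)
  have hm : midpoint ℝ q p ∈ S := hconv.midpoint_mem hq hp
  have h1 := hmin _ hm
  have h2 : midpoint ℝ q p - y = (2⁻¹ : ℝ) • ((q - y) + (p - y)) := by
    rw [midpoint_eq_smul_add, invOf_eq_inv]
    module
  rw [h2, norm_smul, Real.norm_of_nonneg (by norm_num)] at h1
  have h3 := parallelogram_law_with_norm ℝ (q - y) (p - y)
  have h4 : ‖(q - y) - (p - y)‖ * ‖(q - y) - (p - y)‖ ≤ 0 := by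
    rw [heq] at h3
    nlinarith [norm_nonneg (p - y), norm_nonneg (q - y + (p - y))]
  have h5 : ‖(q - y) - (p - y)‖ = 0 := by
    nlinarith [norm_nonneg ((q - y) - (p - y))]
  have h6 : (q - y) - (p - y) = 0 := norm_eq_zero.mp h5
  simpa [sub_eq_zero] using h6

/-- The feasible set `𝒳 = ⋂ᵢ 𝒳ᵢ`, where `𝒳ᵢ = ⋂_{j ∈ Iᵢ} 𝒳ᵢʲ`. -/
def feasibleSet {d m : ℕ} {I : Fin m → Type*}
    (X : (i : Fin m) → I i → Set (EuclideanSpace ℝ (Fin d))) :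
    Set (EuclideanSpace ℝ (Fin d)) :=
  ⋂ i, ⋂ j, X i j

/-- The optimal set `𝒳*`: the minimizers of `f = ∑ᵢ fᵢ` over the feasible set `𝒳`. -/
def optimalSet {d m : ℕ} {I : Fin m → Type*}
    (X : (i : Fin m) → I i → Set (EuclideanSpace ℝ (Fin d)))
    (f : Fin m → EuclideanSpace ℝ (Fin d) → ℝ) : Set (EuclideanSpace ℝ (Fin d)) :=
  {x ∈ feasibleSet X | ∀ y ∈ feasibleSet X, ∑ i, f i x ≤ ∑ i, f i y}

/-- The mixing step: `vᵢ = ∑ⱼ [W]ᵢⱼ xⱼ`. -/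
noncomputable def mix {d m : ℕ} (W : Matrix (Fin m) (Fin m) ℝ)
    (x : Fin m → EuclideanSpace ℝ (Fin d)) (i : Fin m) : EuclideanSpace ℝ (Fin d) :=
  ∑ j, W i j • x j

/-- The distributed random projection algorithm along one realization: `x₀ i` is the initial point
of agent `i` and `s k i` is the constraint index that agent `i` draws at time `k`. The value at
`k` and `i` is the iterate `xᵢ(k)`, where
`vᵢ(k) = ∑ⱼ [W(k)]ᵢⱼ xⱼ(k)` and `xᵢ(k+1) = Π[vᵢ(k) - αₖ ∇fᵢ(vᵢ(k))]`, the projection being the one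
onto the component set of agent `i` with index `s k i`. -/
noncomputable def drp {d m : ℕ} {I : Fin m → Type*}
    (X : (i : Fin m) → I i → Set (EuclideanSpace ℝ (Fin d)))
    (f : Fin m → EuclideanSpace ℝ (Fin d) → ℝ)
    (W : ℕ → Matrix (Fin m) (Fin m) ℝ) (α : ℕ → ℝ)
    (x₀ : Fin m → EuclideanSpace ℝ (Fin d)) (s : ℕ → (i : Fin m) → I i) :
    ℕ → Fin m → EuclideanSpace ℝ (Fin d)
  | 0 => x₀
  | k + 1 => fun i =>
      proj (X i (s k i))
        (mix (W k) (drp X f W α x₀ s k) i -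
          α k • gradient (f i) (mix (W k) (drp X f W α x₀ s k) i))

/-- The directed graph with edge set `E` on the vertices `Fin m` is strongly connected: every
vertex can be reached from every vertex along a directed path. -/
def StronglyConnected {m : ℕ} (E : Set (Fin m × Fin m)) : Prop :=
  ∀ i j, Relation.ReflTransGen (fun a b => (a, b) ∈ E) i j

/-!
Almost sure convergence of the distributed random projection algorithm.

Randomness enters at one point only. Let `C` be the feasible set. One step satisfies, pathwise, for
every `τ > 0`,
`dist²(xᵢ(k+1), C) ≤ (1 + τ + 4L²αₖ²) dist²(vᵢ(k), C) - ½ dist²(vᵢ(k), Xᵢ) + (4 + 1/τ) G² αₖ²`,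
where `Xᵢ` is the drawn component set (`infDist_step_sq_le`). For deterministic initial points,
`vᵢ(k)` is a function of the finitely many draws before time `k`, hence bounded and independent of
the draw at time `k`, so the regularity assumption bounds the expectation of `dist²(vᵢ(k), Xᵢ)`
below by a multiple of that of `dist²(vᵢ(k), C)`. With `τ` small, and since averaging with doubly
stochastic weights does not increase the sum of the `dist²(·, C)`, the sum over `k` of the expected
`dist²(vᵢ(k), C)` is finite (`ae_summable_infDist_sq`). Hence `∑ₖ dist²(vᵢ(k), C) < ∞` almost
surely; Fubini's theorem extends this to random initial points independent of the draws, for which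
no integrability is needed.

The rest is deterministic (`exists_tendsto_of_summable_infDist_sq`). The difference between
`xᵢ(k+1)` and `vᵢ(k)` is square-summable. Products of the weight matrices over a fixed number of
steps have entries bounded below, hence contract the diameter of the set of iterates, so the
disagreement of the agents is square-summable too (`summable_diam_range_sq`). With the feasible
reference point `uₖ`, the projection of one of the `vᵢ(k)` on `C`, one obtains for every minimizer
`p`
`∑ᵢ ‖xᵢ(k+1) - p‖² ≤ ∑ᵢ ‖xᵢ(k) - p‖² - 2 αₖ (f(uₖ) - f(p)) + (summable)`,
so that `∑ᵢ ‖xᵢ(k) - p‖²` converges and `∑ₖ αₖ (f(uₖ) - f(p)) < ∞`. As `∑ₖ αₖ = ∞`, some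
subsequence of `uₖ` converges to a minimizer, and the convergence of the distances to this
particular minimizer forces the whole sequence to converge to it.
-/

/-! ### Projections and distances -/

section Projection

variable {d : ℕ} {S : Set (EuclideanSpace ℝ (Fin d))}

theorem infDist_eq_norm_proj_sub (hne : S.Nonempty) (hc : IsClosed S)
    (y : EuclideanSpace ℝ (Fin d)) : Metric.infDist y S = ‖proj S y - y‖ := by
  refine le_antisymm ?_ ((Metric.le_infDist hne).2 fun v hv => ?_)
  · rw [← dist_eq_norm, dist_comm]
    exact Metric.infDist_le_dist_of_mem (proj_mem hne hc y)
  · rw [dist_comm, dist_eq_norm]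
    exact proj_minimal hne hc y v hv

/-- The variational inequality that characterizes the projection onto a closed convex set. -/
theorem inner_sub_proj_le_zero (hc : IsClosed S) (hconv : Convex ℝ S)
    (y : EuclideanSpace ℝ (Fin d)) {z : EuclideanSpace ℝ (Fin d)} (hz : z ∈ S) :
    inner ℝ (y - proj S y) (z - proj S y) ≤ 0 := by
  have hp := proj_mem ⟨z, hz⟩ hc y
  have hmin := proj_minimal ⟨z, hz⟩ hc y
  refine (norm_eq_iInf_iff_real_inner_le_zero hconv hp).1 ?_ z hz
  have : Nonempty S := ⟨⟨z, hz⟩⟩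
  refine le_antisymm (le_ciInf fun w => ?_)
    (ciInf_le (f := fun w : S => ‖y - w‖) ⟨0, ?_⟩ ⟨_, hp⟩)
  · rw [norm_sub_rev y, norm_sub_rev y]
    exact hmin w w.2
  · rintro _ ⟨w, rfl⟩
    exact norm_nonneg _

theorem norm_proj_sub_sq_le (hc : IsClosed S) (hconv : Convex ℝ S)
    (y : EuclideanSpace ℝ (Fin d)) {z : EuclideanSpace ℝ (Fin d)} (hz : z ∈ S) :
    ‖proj S y - z‖ ^ 2 ≤ ‖y - z‖ ^ 2 - ‖proj S y - y‖ ^ 2 := by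
  have h := inner_sub_proj_le_zero hc hconv y hz
  have h1 : y - z = (y - proj S y) - (z - proj S y) := by abel
  have h2 := norm_sub_sq_real (y - proj S y) (z - proj S y)
  rw [← h1] at h2
  rw [norm_sub_rev (proj S y) z, norm_sub_rev (proj S y) y]
  linarith

theorem norm_proj_sub_proj_le (hne : S.Nonempty) (hc : IsClosed S) (hconv : Convex ℝ S)
    (x y : EuclideanSpace ℝ (Fin d)) : ‖proj S x - proj S y‖ ≤ ‖x - y‖ := by
  have h1 := inner_sub_proj_le_zero hc hconv x (proj_mem hne hc y)
  have h2 := inner_sub_proj_le_zero hc hconv y (proj_mem hne hc x)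
  set p := proj S x
  set q := proj S y
  have h3 : inner ℝ (p - q) (p - q) ≤ inner ℝ (x - y) (p - q) := by
    have h4 : inner ℝ (x - y) (p - q) - inner ℝ (p - q) (p - q)
        = -(inner ℝ (x - p) (q - p)) - inner ℝ (y - q) (p - q) := by
      simp only [inner_sub_left, inner_sub_right]
      ring
    linarith
  rw [real_inner_self_eq_norm_sq] at h3
  have h5 := real_inner_le_norm (x - y) (p - q)
  nlinarith [norm_nonneg (p - q), norm_nonneg (x - y)]

theorem continuous_proj (hne : S.Nonempty) (hc : IsClosed S) (hconv : Convex ℝ S) :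
    Continuous (proj S) := by
  refine LipschitzWith.continuous (K := 1) (LipschitzWith.of_dist_le_mul fun x y => ?_)
  simpa [dist_eq_norm] using norm_proj_sub_proj_le hne hc hconv x y

end Projection

/-! ### Averaging with stochastic weights -/

/-- Jensen's inequality for the squared norm. -/
theorem norm_sum_smul_sq_le {ι V : Type*} [Fintype ι] [SeminormedAddCommGroup V]
    [NormedSpace ℝ V] {w : ι → ℝ} (hw : ∀ j, 0 ≤ w j) (h1 : ∑ j, w j = 1) (y : ι → V) :
    ‖∑ j, w j • y j‖ ^ 2 ≤ ∑ j, w j * ‖y j‖ ^ 2 := by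
  have hc : ConvexOn ℝ Set.univ (fun v : V => ‖v‖ ^ 2) :=
    convexOn_univ_norm.pow (fun _ _ => norm_nonneg _) 2
  simpa using hc.map_sum_le (t := Finset.univ) (w := w) (p := y) (fun j _ => hw j) h1
    (fun _ _ => Set.mem_univ _)

section Mix

variable {d m : ℕ} {W : Matrix (Fin m) (Fin m) ℝ}

theorem mix_sub_const (h1 : ∀ i, ∑ j, W i j = 1) (x : Fin m → EuclideanSpace ℝ (Fin d))
    (z : EuclideanSpace ℝ (Fin d)) (i : Fin m) :
    mix W x i - z = ∑ j, W i j • (x j - z) := by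
  simp [mix, smul_sub, Finset.sum_sub_distrib, ← Finset.sum_smul, h1]

theorem mix_mul (A B : Matrix (Fin m) (Fin m) ℝ) (x : Fin m → EuclideanSpace ℝ (Fin d)) :
    mix (A * B) x = mix A (mix B x) := by
  funext i
  simp only [mix, Matrix.mul_apply, Finset.sum_smul, Finset.smul_sum, smul_smul]
  exact Finset.sum_comm

theorem sum_sum_mul_of_col (hcol : ∀ j, ∑ i, W i j = 1) (a : Fin m → ℝ) :
    ∑ i, ∑ j, W i j * a j = ∑ j, a j := by
  rw [Finset.sum_comm]
  simp [← Finset.sum_mul, hcol]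

theorem sum_norm_mix_sub_sq_le (h0 : ∀ i j, 0 ≤ W i j) (h1 : ∀ i, ∑ j, W i j = 1)
    (hcol : ∀ j, ∑ i, W i j = 1) (x : Fin m → EuclideanSpace ℝ (Fin d))
    (z : EuclideanSpace ℝ (Fin d)) :
    ∑ i, ‖mix W x i - z‖ ^ 2 ≤ ∑ i, ‖x i - z‖ ^ 2 := by
  rw [← sum_sum_mul_of_col hcol (fun j => ‖x j - z‖ ^ 2)]
  refine Finset.sum_le_sum fun i _ => ?_
  rw [mix_sub_const h1]
  exact norm_sum_smul_sq_le (h0 i) (h1 i) _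

theorem sum_infDist_mix_sq_le (h0 : ∀ i j, 0 ≤ W i j) (h1 : ∀ i, ∑ j, W i j = 1)
    (hcol : ∀ j, ∑ i, W i j = 1) {S : Set (EuclideanSpace ℝ (Fin d))} (hne : S.Nonempty)
    (hc : IsClosed S) (hconv : Convex ℝ S) (x : Fin m → EuclideanSpace ℝ (Fin d)) :
    ∑ i, Metric.infDist (mix W x i) S ^ 2 ≤ ∑ i, Metric.infDist (x i) S ^ 2 := by
  rw [← sum_sum_mul_of_col hcol (fun j => Metric.infDist (x j) S ^ 2)]
  refine Finset.sum_le_sum fun i _ => ?_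
  have hmem : ∑ j, W i j • proj S (x j) ∈ S :=
    hconv.sum_mem (fun j _ => h0 i j) (h1 i) fun j _ => proj_mem hne hc _
  have hle : Metric.infDist (mix W x i) S ≤ ‖∑ j, W i j • (x j - proj S (x j))‖ := by
    refine (Metric.infDist_le_dist_of_mem hmem).trans_eq ?_
    simp [mix, dist_eq_norm, smul_sub, Finset.sum_sub_distrib]
  refine (pow_le_pow_left₀ Metric.infDist_nonneg hle 2).trans ?_
  refine (norm_sum_smul_sq_le (h0 i) (h1 i) _).trans_eq ?_
  refine Finset.sum_congr rfl fun j _ => ?_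
  rw [infDist_eq_norm_proj_sub hne hc, norm_sub_rev]

end Mix

/-! ### Convex differentiable functions -/

/-- A differentiable convex function lies above its tangent planes. -/
theorem ConvexOn.add_inner_gradient_le {V : Type*} [NormedAddCommGroup V]
    [InnerProductSpace ℝ V] [CompleteSpace V] {f : V → ℝ} (hf : ConvexOn ℝ Set.univ f)
    (hdiff : Differentiable ℝ f) (x y : V) :
    f x + inner ℝ (gradient f x) (y - x) ≤ f y := by
  have hg : ConvexOn ℝ Set.univ (f ∘ AffineMap.lineMap (k := ℝ) x y) := by
    simpa using hf.comp_affineMap (AffineMap.lineMap x y)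
  have hder : HasDerivAt (f ∘ AffineMap.lineMap (k := ℝ) x y)
      (inner ℝ (gradient f x) (y - x)) 0 := by
    have h1 : HasDerivAt (AffineMap.lineMap x y : ℝ → V) (y - x) 0 :=
      AffineMap.hasDerivAt_lineMap
    have h2 := (hdiff (AffineMap.lineMap x y (0 : ℝ))).hasGradientAt.hasFDerivAt
    have h3 := h2.comp_hasDerivAt (0 : ℝ) h1
    rwa [AffineMap.lineMap_apply_zero, InnerProductSpace.toDual_apply_apply] at h3
  have h3 := hg.le_slope_of_hasDerivAt (Set.mem_univ 0) (Set.mem_univ 1) one_pos hder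
  rw [slope_def_field, Function.comp_apply, Function.comp_apply, AffineMap.lineMap_apply_zero,
    AffineMap.lineMap_apply_one, sub_zero, div_one] at h3
  linarith

/-! ### Real sequences -/

/-- Deterministic Robbins–Siegmund lemma: convergence and summability for a nonnegative sequence
that decreases by `c k` up to summable errors. -/
theorem tendsto_and_summable_of_le_sub_add {a b c : ℕ → ℝ} (ha : ∀ k, 0 ≤ a k)
    (hb : ∀ k, 0 ≤ b k) (hc : ∀ k, 0 ≤ c k) (hsum : Summable b)
    (h : ∀ k, a (k + 1) ≤ a k - c k + b k) :
    (∃ l, Tendsto a atTop (𝓝 l)) ∧ Summable c := by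
  set B : ℕ → ℝ := fun n => ∑ k ∈ Finset.range n, b k
  have hB : Tendsto B atTop (𝓝 (∑' k, b k)) := hsum.hasSum.tendsto_sum_nat
  have hBle : ∀ n, B n ≤ ∑' k, b k := fun n => hsum.sum_le_tsum _ fun k _ => hb k
  constructor
  · have hanti : Antitone (fun n => a n - B n) := antitone_nat_of_succ_le fun n => by
      simp only [B, Finset.sum_range_succ]
      linarith [h n, hc n]
    have hbdd : BddBelow (Set.range fun n => a n - B n) :=
      ⟨-∑' k, b k, by rintro _ ⟨n, rfl⟩; simp only; linarith [ha n, hBle n]⟩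
    refine ⟨_, ((tendsto_atTop_ciInf hanti hbdd).add hB).congr fun n => ?_⟩
    ring
  · refine summable_of_sum_range_le (c := a 0 + ∑' k, b k) hc fun n => ?_
    have key : ∑ k ∈ Finset.range n, c k ≤ a 0 - a n + B n := by
      induction n with
      | zero => simp [B]
      | succ n ih =>
        simp only [B, Finset.sum_range_succ] at ih ⊢
        linarith [h n]
    linarith [ha n, hBle n]

/-- A nonnegative sequence which contracts over `T` steps, up to a summable error, is summable. -/
theorem summable_of_add_le_mul_add {w c : ℕ → ℝ} {ρ : ℝ} (T : ℕ) (hρ : ρ < 1)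
    (hw : ∀ k, 0 ≤ w k) (hc : ∀ k, 0 ≤ c k) (hsum : Summable c)
    (h : ∀ k, w (k + T) ≤ ρ * w k + c k) : Summable w := by
  refine summable_of_sum_range_le
    (c := (∑ k ∈ Finset.range T, w k + ∑' k, c k) / (1 - ρ)) hw fun n => ?_
  rw [le_div_iff₀ (by linarith)]
  have h1 : ∑ k ∈ Finset.range n, w k ≤ ∑ k ∈ Finset.range (T + n), w k :=
    Finset.sum_le_sum_of_subset_of_nonneg (Finset.range_mono (by omega)) fun k _ _ => hw k
  rw [Finset.sum_range_add] at h1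
  have h2 : ∑ k ∈ Finset.range n, w (T + k) ≤
      ρ * ∑ k ∈ Finset.range n, w k + ∑ k ∈ Finset.range n, c k := by
    rw [Finset.mul_sum, ← Finset.sum_add_distrib]
    exact Finset.sum_le_sum fun k _ => by rw [add_comm T]; exact h k
  have h3 : ∑ k ∈ Finset.range n, c k ≤ ∑' k, c k := hsum.sum_le_tsum _ fun k _ => hc k
  nlinarith

theorem Summable.mul_of_sq {a b : ℕ → ℝ} (ha : Summable fun k => a k ^ 2)
    (hb : Summable fun k => b k ^ 2) : Summable fun k => a k * b k := by
  refine Summable.of_norm_bounded (ha.add hb) fun k => ?_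
  rw [Real.norm_eq_abs, abs_le]
  constructor <;> nlinarith [sq_nonneg (a k + b k), sq_nonneg (a k - b k)]

theorem Summable.sq_add {a b : ℕ → ℝ} (ha : Summable fun k => a k ^ 2)
    (hb : Summable fun k => b k ^ 2) : Summable fun k => (a k + b k) ^ 2 :=
  ((ha.add hb).add ((ha.mul_of_sq hb).mul_left 2)).congr fun k => by ring

theorem Summable.sq_const_mul {a : ℕ → ℝ} (ha : Summable fun k => a k ^ 2) (C : ℝ) :
    Summable fun k => (C * a k) ^ 2 :=
  (ha.mul_left (C ^ 2)).congr fun k => by ring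

theorem Summable.sq_sum {ι : Type*} (s : Finset ι) {a : ι → ℕ → ℝ}
    (ha : ∀ i ∈ s, Summable fun k => a i k ^ 2) : Summable fun k => (∑ i ∈ s, a i k) ^ 2 := by
  classical
  induction s using Finset.induction_on with
  | empty => simp
  | insert i s hi ih =>
    simp only [Finset.sum_insert hi]
    exact (ha i (by simp)).sq_add (ih fun j hj => ha j (by simp [hj]))

theorem Summable.tendsto_zero_of_sq {a : ℕ → ℝ} (ha : Summable fun k => a k ^ 2) :
    Tendsto a atTop (𝓝 0) := by
  have h := ha.tendsto_atTop_zero.sqrt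
  simp only [Real.sqrt_sq_eq_abs, Real.sqrt_zero] at h
  exact (tendsto_zero_iff_abs_tendsto_zero a).2 h

/-- If `∑ αₖ = ∞` and `∑ αₖ wₖ < ∞`, then `wₖ` is small infinitely often. -/
theorem frequently_lt_of_summable_mul {α w : ℕ → ℝ} (hα : ∀ k, 0 < α k)
    (hα_sum : Tendsto (fun n => ∑ k ∈ Finset.range n, α k) atTop atTop)
    (hsum : Summable fun k => α k * w k) {ε : ℝ} (hε : 0 < ε) : ∃ᶠ k in atTop, w k < ε := by
  intro hev
  have hs : Summable α := by
    refine (hsum.mul_left ε⁻¹).of_norm_bounded_eventually_nat ?_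
    filter_upwards [hev] with k hk
    rw [Real.norm_of_nonneg (hα k).le, ← mul_assoc, mul_comm ε⁻¹, mul_assoc]
    have : 1 ≤ ε⁻¹ * w k := by
      rw [inv_mul_eq_div, le_div_iff₀ hε]; linarith [not_lt.1 hk]
    nlinarith [hα k]
  exact not_tendsto_atTop_of_tendsto_nhds hs.hasSum.tendsto_sum_nat hα_sum

/-! ### Consensus under square-summable perturbations -/

section Consensus

variable {d m : ℕ}

/-- The product `W(k+t-1) ⋯ W(k)` of the weight matrices over `t` steps that start at time `k`. -/
def transition (W : ℕ → Matrix (Fin m) (Fin m) ℝ) (k : ℕ) : ℕ → Matrix (Fin m) (Fin m) ℝ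
  | 0 => 1
  | t + 1 => W (k + t) * transition W k t

variable {W : ℕ → Matrix (Fin m) (Fin m) ℝ}

theorem transition_nonneg (h0 : ∀ k i j, 0 ≤ W k i j) (k t : ℕ) (i j : Fin m) :
    0 ≤ transition W k t i j := by
  induction t generalizing i with
  | zero =>
    simp only [transition, Matrix.one_apply]
    split_ifs <;> norm_num
  | succ t ih =>
    rw [transition, Matrix.mul_apply]
    exact Finset.sum_nonneg fun l _ => mul_nonneg (h0 _ _ _) (ih l)

theorem sum_transition (h1 : ∀ k i, ∑ j, W k i j = 1) (k t : ℕ) (i : Fin m) :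
    ∑ j, transition W k t i j = 1 := by
  induction t generalizing i with
  | zero => simp [transition, Matrix.one_apply]
  | succ t ih =>
    simp only [transition, Matrix.mul_apply]
    rw [Finset.sum_comm]
    simp [← Finset.mul_sum, ih, h1]

theorem pow_le_transition_succ {E : ℕ → Set (Fin m × Fin m)} {η : ℝ} (hη : 0 < η)
    (h0 : ∀ k i j, 0 ≤ W k i j) (hlow : ∀ k i j, (i, j) ∈ E k → η ≤ W k i j)
    {k t : ℕ} {i j l : Fin m} (hij : (i, j) ∈ E (k + t))
    (h : η ^ t ≤ transition W k t j l) : η ^ (t + 1) ≤ transition W k (t + 1) i l := by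
  rw [transition, Matrix.mul_apply, pow_succ']
  refine (mul_le_mul (hlow _ _ _ hij) h (by positivity) (h0 _ _ _)).trans ?_
  exact Finset.single_le_sum (f := fun j => W (k + t) i j * transition W k t j l)
    (fun a _ => mul_nonneg (h0 _ _ _) (transition_nonneg h0 _ _ _ _)) (Finset.mem_univ j)

/-- Over `m * Q` steps or more, the information of every agent `l` reaches every agent: the set of
agents it has reached never shrinks, because of the self-loops, and grows within any `Q` steps,
because of connectivity, until it is everything. -/
theorem pow_le_transition {E : ℕ → Set (Fin m × Fin m)} {η : ℝ} (hη : 0 < η)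
    (h0 : ∀ k i j, 0 ≤ W k i j) (hlow : ∀ k i j, (i, j) ∈ E k → η ≤ W k i j)
    (hself : ∀ k i, (i, i) ∈ E k) {Q : ℕ}
    (hconn : ∀ k, StronglyConnected (⋃ l ∈ Finset.range Q, E (k + l)))
    {t : ℕ} (ht : m * Q ≤ t) (k : ℕ) (i l : Fin m) : η ^ t ≤ transition W k t i l := by
  classical
  set R : ℕ → Finset (Fin m) := fun t => Finset.univ.filter fun i => η ^ t ≤ transition W k t i l
  have hmem : ∀ t i, i ∈ R t ↔ η ^ t ≤ transition W k t i l := by simp [R]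
  have hmono : Monotone R := monotone_nat_of_le_succ fun t i hi =>
    (hmem _ _).2 (pow_le_transition_succ hη h0 hlow (hself _ _) ((hmem _ _).1 hi))
  have hl : l ∈ R 0 := by simp [R, transition]
  have hgrow : ∀ t, R t ≠ Finset.univ → (R t).card < (R (t + Q)).card := by
    intro t hne
    obtain ⟨i, hi⟩ : ∃ i, i ∉ R t := by
      by_contra! hall
      exact hne (Finset.eq_univ_iff_forall.2 hall)
    -- a path from an unreached agent to `l` contains an edge that enters the reached set
    have hcross : ∃ a b, a ∉ R t ∧ b ∈ R t ∧ (a, b) ∈ ⋃ s ∈ Finset.range Q, E (k + t + s) := by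
      have hpath := hconn (k + t) i l
      by_contra! hno
      have hstay : ∀ b, Relation.ReflTransGen
          (fun a b => (a, b) ∈ ⋃ s ∈ Finset.range Q, E (k + t + s)) i b → b ∉ R t := by
        intro b hb
        induction hb with
        | refl => exact hi
        | tail _ hbc ih => exact fun hc => hno _ _ ih hc hbc
      exact hstay l hpath (hmono (Nat.zero_le t) hl)
    obtain ⟨a, b, ha, hb, hab⟩ := hcross
    simp only [Set.mem_iUnion, Finset.mem_range, exists_prop] at hab
    obtain ⟨s, hs, hab⟩ := hab
    refine Finset.card_lt_card (Finset.ssubset_iff_of_subset (hmono (by omega)) |>.2 ⟨a, ?_, ha⟩)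
    refine hmono (show t + s + 1 ≤ t + Q by omega) ((hmem _ _).2 ?_)
    refine pow_le_transition_succ hη h0 hlow (by rwa [← add_assoc]) ((hmem _ _).1 ?_)
    exact hmono (Nat.le_add_right t s) hb
  have hcard : ∀ n, R (n * Q) = Finset.univ ∨ n ≤ (R (n * Q)).card := by
    intro n
    induction n with
    | zero => simp
    | succ n ih =>
      rw [Nat.succ_mul]
      by_cases hu : R (n * Q) = Finset.univ
      · exact Or.inl (Finset.univ_subset_iff.1 (hu ▸ hmono (Nat.le_add_right _ Q)))
      · exact Or.inr ((ih.resolve_left hu).trans_lt (hgrow _ hu))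
  have huniv : R (m * Q) = Finset.univ := by
    refine (hcard m).elim id fun h => ?_
    rw [← Finset.card_eq_iff_eq_univ]
    exact le_antisymm (Finset.card_le_univ _) (by simpa using h)
  exact (hmem _ _).1 (hmono ht (huniv ▸ Finset.mem_univ i))

/-- A stochastic matrix with a column bounded below by `ε` contracts differences by `1 - ε`. -/
theorem norm_mix_sub_mix_le {P : Matrix (Fin m) (Fin m) ℝ} (h0 : ∀ i j, 0 ≤ P i j)
    (h1 : ∀ i, ∑ j, P i j = 1) {ε : ℝ} (hε : ε < 1) {l : Fin m} (hl : ∀ i, ε ≤ P i l)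
    {x : Fin m → EuclideanSpace ℝ (Fin d)} {D : ℝ} (hD : ∀ i j, ‖x i - x j‖ ≤ D) (i j : Fin m) :
    ‖mix P x i - mix P x j‖ ≤ (1 - ε) * D := by
  -- both rows minus `ε` times the unit vector of the common column have total mass `1 - ε`
  set a : Fin m → Fin m → ℝ := fun i r => P i r - if r = l then ε else 0
  have ha0 : ∀ i r, 0 ≤ a i r := by
    intro i r
    simp only [a]
    split_ifs with h
    · subst h; linarith [hl i]
    · simpa using h0 i r
  have ha1 : ∀ i, ∑ r, a i r = 1 - ε := fun i => by simp [a, Finset.sum_sub_distrib, h1]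
  have hmix : ∀ i, mix P x i = ∑ r, a i r • x r + ε • x l := by
    intro i
    simp [mix, a, sub_smul, Finset.sum_sub_distrib, ite_smul]
  have hdouble : (1 - ε) • (mix P x i - mix P x j) =
      ∑ r, ∑ s, (a i r * a j s) • (x r - x s) := by
    have e1 : ∑ r, ∑ s, (a i r * a j s) • x r = (1 - ε) • ∑ r, a i r • x r := by
      simp only [← Finset.sum_smul, ← Finset.mul_sum, ha1, Finset.smul_sum, smul_smul]
      exact Finset.sum_congr rfl fun r _ => by rw [mul_comm]
    have e2 : ∑ r, ∑ s, (a i r * a j s) • x s = (1 - ε) • ∑ s, a j s • x s := by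
      rw [Finset.sum_comm]
      simp only [← Finset.sum_smul, ← Finset.sum_mul, ha1, Finset.smul_sum, smul_smul]
    simp only [smul_sub, Finset.sum_sub_distrib, e1, e2, hmix]
    rw [← smul_sub, ← smul_sub]
    congr 1
    abel
  have hbound : ‖(1 - ε) • (mix P x i - mix P x j)‖ ≤ (1 - ε) * (1 - ε) * D := by
    rw [hdouble]
    calc ‖∑ r, ∑ s, (a i r * a j s) • (x r - x s)‖
        ≤ ∑ r, ∑ s, a i r * a j s * D := by
          refine norm_sum_le_of_le _ fun r _ => norm_sum_le_of_le _ fun s _ => ?_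
          rw [norm_smul, Real.norm_of_nonneg (mul_nonneg (ha0 _ _) (ha0 _ _))]
          exact mul_le_mul_of_nonneg_left (hD r s) (mul_nonneg (ha0 _ _) (ha0 _ _))
      _ = (1 - ε) * (1 - ε) * D := by
          simp only [← Finset.sum_mul, ← Finset.mul_sum, ha1]
  rw [norm_smul, Real.norm_of_nonneg (by linarith), mul_assoc] at hbound
  exact le_of_mul_le_mul_left hbound (by linarith)

theorem norm_sub_mix_transition_le (h0 : ∀ k i j, 0 ≤ W k i j)
    (h1 : ∀ k i, ∑ j, W k i j = 1) {x : ℕ → Fin m → EuclideanSpace ℝ (Fin d)} {e : ℕ → ℝ}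
    (he : ∀ k i, ‖x (k + 1) i - mix (W k) (x k) i‖ ≤ e k) (k t : ℕ) (i : Fin m) :
    ‖x (k + t) i - mix (transition W k t) (x k) i‖ ≤ ∑ s ∈ Finset.range t, e (k + s) := by
  induction t generalizing i with
  | zero => simp [transition, mix, Matrix.one_apply, ite_smul]
  | succ t ih =>
    rw [transition, mix_mul, Finset.sum_range_succ]
    set y := mix (transition W k t) (x k)
    have h2 : ‖mix (W (k + t)) (x (k + t)) i - mix (W (k + t)) y i‖ ≤
        ∑ s ∈ Finset.range t, e (k + s) := by
      simp only [mix, ← Finset.sum_sub_distrib, ← smul_sub]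
      calc ‖∑ j, W (k + t) i j • (x (k + t) j - y j)‖
          ≤ ∑ j, W (k + t) i j * ∑ s ∈ Finset.range t, e (k + s) := by
            refine norm_sum_le_of_le _ fun j _ => ?_
            rw [norm_smul, Real.norm_of_nonneg (h0 _ _ _)]
            exact mul_le_mul_of_nonneg_left (ih j) (h0 _ _ _)
        _ = _ := by rw [← Finset.sum_mul, h1, one_mul]
    calc ‖x (k + (t + 1)) i - mix (W (k + t)) y i‖
        = ‖(mix (W (k + t)) (x (k + t)) i - mix (W (k + t)) y i) +
            (x (k + t + 1) i - mix (W (k + t)) (x (k + t)) i)‖ := by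
          rw [← add_assoc k t 1]; congr 1; abel
      _ ≤ _ := (norm_add_le _ _).trans (add_le_add h2 (he _ _))

theorem norm_sub_le_diam_range (x : Fin m → EuclideanSpace ℝ (Fin d)) (i j : Fin m) :
    ‖x i - x j‖ ≤ Metric.diam (Set.range x) := by
  rw [← dist_eq_norm]
  exact Metric.dist_le_diam_of_mem (Set.finite_range x).isBounded ⟨i, rfl⟩ ⟨j, rfl⟩

/-- Square-summable perturbations of the consensus iteration leave the disagreement
square-summable. -/
theorem summable_diam_range_sq {E : ℕ → Set (Fin m × Fin m)} {η : ℝ} (hη : 0 < η) (hη1 : η < 1)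
    (h0 : ∀ k i j, 0 ≤ W k i j) (h1 : ∀ k i, ∑ j, W k i j = 1)
    (hlow : ∀ k i j, (i, j) ∈ E k → η ≤ W k i j)
    (hself : ∀ k i, (i, i) ∈ E k) {Q : ℕ}
    (hconn : ∀ k, StronglyConnected (⋃ l ∈ Finset.range Q, E (k + l)))
    {x : ℕ → Fin m → EuclideanSpace ℝ (Fin d)} {e : ℕ → ℝ}
    (he : ∀ k i, ‖x (k + 1) i - mix (W k) (x k) i‖ ≤ e k) (hsum : Summable fun k => e k ^ 2) :
    Summable fun k => Metric.diam (Set.range (x k)) ^ 2 := by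
  rcases isEmpty_or_nonempty (Fin m) with hm | ⟨⟨l⟩⟩
  · simp [Set.range_eq_empty]
  -- one more step than `m * Q`, so that `η ^ T < 1`
  set T := m * Q + 1
  set ε := η ^ T
  have hε : 0 < ε := by positivity
  have hε1 : ε < 1 := pow_lt_one₀ hη.le hη1 (by omega)
  set c : ℕ → ℝ := fun k => ∑ s ∈ Finset.range T, e (k + s)
  have he0 : ∀ k, 0 ≤ e k := fun k => (norm_nonneg _).trans (he k l)
  have hc : Summable fun k => c k ^ 2 :=
    Summable.sq_sum _ fun s _ => (summable_nat_add_iff (f := fun k => e k ^ 2) s).2 hsum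
  have hstep : ∀ k, Metric.diam (Set.range (x (k + T))) ≤
      (1 - ε) * Metric.diam (Set.range (x k)) + 2 * c k := by
    intro k
    have hc0 : 0 ≤ c k := Finset.sum_nonneg fun s _ => he0 _
    refine Metric.diam_le_of_forall_dist_le
      (add_nonneg (mul_nonneg (by linarith) Metric.diam_nonneg) (by linarith)) ?_
    rintro _ ⟨i, rfl⟩ _ ⟨j, rfl⟩
    have hi := norm_sub_mix_transition_le h0 h1 he k T i
    have hj := norm_sub_mix_transition_le h0 h1 he k T j
    have hij := norm_mix_sub_mix_le (transition_nonneg h0 k T) (sum_transition h1 k T) hε1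
      (fun i => pow_le_transition hη h0 hlow hself hconn (by omega) k i l)
      (norm_sub_le_diam_range (x k)) i j
    rw [dist_eq_norm]
    set y := mix (transition W k T) (x k)
    have hsplit : x (k + T) i - x (k + T) j =
        (y i - y j) + ((x (k + T) i - y i) - (x (k + T) j - y j)) := by abel
    rw [hsplit]
    refine (norm_add_le _ _).trans (add_le_add hij ((norm_sub_le _ _).trans ?_))
    simp only [c]
    linarith
  refine summable_of_add_le_mul_add (ρ := 1 - ε) (c := fun k => ε * (2 / ε * c k) ^ 2) T
    (by linarith) (fun k => sq_nonneg _) (fun k => by positivity)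
    ((hc.sq_const_mul (2 / ε)).mul_left ε) fun k => ?_
  refine (pow_le_pow_left₀ Metric.diam_nonneg (hstep k) 2).trans ?_
  set u := Metric.diam (Set.range (x k))
  -- convexity of the square, for the weights `1 - ε` and `ε`
  have h2 : 2 * c k = ε * (2 / ε * c k) := by field_simp
  rw [h2]
  nlinarith [mul_nonneg (mul_nonneg hε.le (sub_nonneg.2 hε1.le)) (sq_nonneg (u - 2 / ε * c k))]

end Consensus

/-! ### One projected gradient step -/

section Step

variable {d : ℕ} {C S : Set (EuclideanSpace ℝ (Fin d))} {f : EuclideanSpace ℝ (Fin d) → ℝ}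
  {G L a : ℝ}

theorem norm_gradient_le_add_infDist (hne : C.Nonempty) (hc : IsClosed C)
    (hLip : ∀ x y, ‖gradient f x - gradient f y‖ ≤ L * ‖x - y‖)
    (hG : ∀ x ∈ C, ‖gradient f x‖ ≤ G) (v : EuclideanSpace ℝ (Fin d)) :
    ‖gradient f v‖ ≤ G + L * Metric.infDist v C := by
  have h1 := hLip v (proj C v)
  rw [norm_sub_rev v, ← infDist_eq_norm_proj_sub hne hc] at h1
  have h2 := hG _ (proj_mem hne hc v)
  have h3 := norm_le_insert' (gradient f v) (gradient f (proj C v))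
  linarith

theorem norm_step_sub_le (hne : C.Nonempty) (hc : IsClosed C) (hSc : IsClosed S)
    (hCS : C ⊆ S) (ha : 0 ≤ a)
    (hLip : ∀ x y, ‖gradient f x - gradient f y‖ ≤ L * ‖x - y‖)
    (hG : ∀ x ∈ C, ‖gradient f x‖ ≤ G) (v : EuclideanSpace ℝ (Fin d)) :
    ‖proj S (v - a • gradient f v) - v‖ ≤
      Metric.infDist v C + 2 * a * (G + L * Metric.infDist v C) := by
  have hg := norm_gradient_le_add_infDist hne hc hLip hG v
  have hz := proj_mem hne hc v
  have h1 := proj_minimal (hne.mono hCS) hSc (v - a • gradient f v) _ (hCS hz)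
  rw [infDist_eq_norm_proj_sub hne hc] at hg ⊢
  set g := gradient f v
  set z := proj C v
  set p := proj S (v - a • g)
  have hag : ‖a • g‖ = a * ‖g‖ := by rw [norm_smul, Real.norm_of_nonneg ha]
  have h2 : ‖z - (v - a • g)‖ ≤ ‖z - v‖ + a * ‖g‖ := by
    rw [← hag, sub_sub_eq_add_sub, add_sub_right_comm]
    exact norm_add_le _ _
  have h3 : ‖p - v‖ ≤ ‖p - (v - a • g)‖ + a * ‖g‖ := by
    rw [← hag]
    have h := norm_sub_le (p - (v - a • g)) (a • g)
    rwa [show p - (v - a • g) - a • g = p - v by abel] at h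
  nlinarith [mul_le_mul_of_nonneg_left hg ha]

/-- One step brings the iterate closer to the target set `C`, by the squared distance of `v` to the
set `S` that is projected on, up to an error of second order in the stepsize. -/
theorem infDist_step_sq_le (hf : ConvexOn ℝ Set.univ f) (hdiff : Differentiable ℝ f)
    (hne : C.Nonempty) (hc : IsClosed C) (hSc : IsClosed S)
    (hSconv : Convex ℝ S) (hCS : C ⊆ S) (ha : 0 ≤ a)
    (hLip : ∀ x y, ‖gradient f x - gradient f y‖ ≤ L * ‖x - y‖)
    (hG : ∀ x ∈ C, ‖gradient f x‖ ≤ G) {τ : ℝ} (hτ : 0 < τ)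
    (v : EuclideanSpace ℝ (Fin d)) :
    Metric.infDist (proj S (v - a • gradient f v)) C ^ 2 ≤
      (1 + τ + 4 * L ^ 2 * a ^ 2) * Metric.infDist v C ^ 2 - 1 / 2 * Metric.infDist v S ^ 2
        + (4 + 1 / τ) * G ^ 2 * a ^ 2 := by
  have hg := norm_gradient_le_add_infDist hne hc hLip hG v
  have hz := proj_mem hne hc v
  have hD := infDist_eq_norm_proj_sub hne hc v
  have hGz := hG _ hz
  have h1 : Metric.infDist (proj S (v - a • gradient f v)) C ≤
      ‖proj S (v - a • gradient f v) - proj C v‖ := by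
    rw [← dist_eq_norm]
    exact Metric.infDist_le_dist_of_mem hz
  have h2 := norm_proj_sub_sq_le hSc hSconv (v - a • gradient f v) (hCS hz)
  have h3 : Metric.infDist v S ≤ ‖proj S (v - a • gradient f v) - (v - a • gradient f v)‖
      + a * ‖gradient f v‖ := by
    refine (Metric.infDist_le_dist_of_mem
      (proj_mem (hne.mono hCS) hSc (v - a • gradient f v))).trans ?_
    rw [dist_comm, dist_eq_norm]
    have h := norm_sub_le (proj S (v - a • gradient f v) - (v - a • gradient f v))
      (a • gradient f v)
    rwa [norm_smul, Real.norm_of_nonneg ha, sub_sub, sub_add_cancel] at h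
  have h4 := hf.add_inner_gradient_le hdiff v (proj C v)
  have h5 := hf.add_inner_gradient_le hdiff (proj C v) v
  set g := gradient f v
  set z := proj C v
  set p := proj S (v - a • g)
  set D := Metric.infDist v C
  have hD0 : 0 ≤ D := Metric.infDist_nonneg
  have h6 : -inner ℝ g (v - z) ≤ G * D := by
    have h7 : inner ℝ g (z - v) = -inner ℝ g (v - z) := by rw [← inner_neg_right, neg_sub]
    have h8 := (abs_le.1 (abs_real_inner_le_norm (gradient f z) (v - z))).1
    rw [norm_sub_rev v z, ← hD] at h8
    nlinarith [mul_le_mul_of_nonneg_right hGz hD0]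
  have h9 : ‖v - a • g - z‖ ^ 2 = D ^ 2 - 2 * a * inner ℝ g (v - z) + a ^ 2 * ‖g‖ ^ 2 := by
    rw [show v - a • g - z = (v - z) - a • g by abel, norm_sub_sq_real, real_inner_smul_right,
      real_inner_comm, norm_smul, Real.norm_of_nonneg ha, norm_sub_rev v z, ← hD]
    ring
  -- weighted Young inequality, and two crude bounds for squares of sums
  have h10 : 2 * a * (G * D) ≤ τ * D ^ 2 + 1 / τ * G ^ 2 * a ^ 2 := by
    have h : 0 ≤ τ * (D - 1 / τ * G * a) ^ 2 := by positivity
    have h' : τ * (D - 1 / τ * G * a) ^ 2 =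
        τ * D ^ 2 + 1 / τ * G ^ 2 * a ^ 2 - 2 * a * (G * D) := by
      field_simp
      ring
    linarith
  have h11 : ‖g‖ ^ 2 ≤ 2 * G ^ 2 + 2 * L ^ 2 * D ^ 2 := by
    nlinarith [pow_le_pow_left₀ (norm_nonneg g) hg 2, sq_nonneg (G - L * D)]
  have h12 : Metric.infDist v S ^ 2 ≤ 2 * ‖p - (v - a • g)‖ ^ 2 + 2 * (a ^ 2 * ‖g‖ ^ 2) := by
    nlinarith [pow_le_pow_left₀ Metric.infDist_nonneg h3 2,
      sq_nonneg (‖p - (v - a • g)‖ - a * ‖g‖)]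
  have h13 := pow_le_pow_left₀ Metric.infDist_nonneg h1 2
  have h14 := mul_le_mul_of_nonneg_left h6 (show 0 ≤ 2 * a by linarith)
  have h15 := mul_le_mul_of_nonneg_left h11 (sq_nonneg a)
  nlinarith

/-- Progress of one step towards a feasible point `p`, measured by the decrease of `f` at an
arbitrary feasible reference point `u`. -/
theorem norm_step_sub_sq_le (hf : ConvexOn ℝ Set.univ f) (hdiff : Differentiable ℝ f)
    (hc : IsClosed C) (hSc : IsClosed S)
    (hSconv : Convex ℝ S) (hCS : C ⊆ S) (ha : 0 ≤ a)
    (hLip : ∀ x y, ‖gradient f x - gradient f y‖ ≤ L * ‖x - y‖)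
    (hG : ∀ x ∈ C, ‖gradient f x‖ ≤ G) {p u : EuclideanSpace ℝ (Fin d)} (hp : p ∈ C)
    (hu : u ∈ C) (v : EuclideanSpace ℝ (Fin d)) :
    ‖proj S (v - a • gradient f v) - p‖ ^ 2 ≤ ‖v - p‖ ^ 2 - 2 * a * (f u - f p)
      + 2 * G * (a * ‖v - u‖) + (a * (G + L * Metric.infDist v C)) ^ 2 := by
  have hg := norm_gradient_le_add_infDist ⟨p, hp⟩ hc hLip hG v
  have h2 := norm_proj_sub_sq_le hSc hSconv (v - a • gradient f v) (hCS hp)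
  have h4 := hf.add_inner_gradient_le hdiff v p
  have h5 := hf.add_inner_gradient_le hdiff u v
  set g := gradient f v
  have h7 : inner ℝ g (p - v) = -inner ℝ g (v - p) := by rw [← inner_neg_right, neg_sub]
  have h8 := (abs_le.1 (abs_real_inner_le_norm (gradient f u) (v - u))).1
  have h9 : ‖v - a • g - p‖ ^ 2 = ‖v - p‖ ^ 2 - 2 * a * inner ℝ g (v - p) + a ^ 2 * ‖g‖ ^ 2 := by
    rw [show v - a • g - p = (v - p) - a • g by abel, norm_sub_sq_real, real_inner_smul_right,
      real_inner_comm, norm_smul, Real.norm_of_nonneg ha]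
    ring
  have h10 : -inner ℝ g (v - p) ≤ -(f u - f p) + G * ‖v - u‖ := by
    nlinarith [mul_le_mul_of_nonneg_right (hG u hu) (norm_nonneg (v - u))]
  have h11 := mul_le_mul_of_nonneg_left h10 (show 0 ≤ 2 * a by linarith)
  have h12 := pow_le_pow_left₀ (norm_nonneg g) hg 2
  have h13 := mul_le_mul_of_nonneg_left h12 (sq_nonneg a)
  nlinarith [sq_nonneg ‖proj S (v - a • g) - (v - a • g)‖]

end Step

/-! ### Convergence of one realization -/

/-- If the squared distances of the mixed iterates to the feasible set `C` are summable, then all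
agents converge to a common minimizer. No randomness is involved. -/
theorem exists_tendsto_of_summable_infDist_sq {d m : ℕ}
    {C : Set (EuclideanSpace ℝ (Fin d))} (hc : IsClosed C)
    {S : ℕ → Fin m → Set (EuclideanSpace ℝ (Fin d))} (hSc : ∀ k i, IsClosed (S k i))
    (hSconv : ∀ k i, Convex ℝ (S k i)) (hCS : ∀ k i, C ⊆ S k i)
    {f : Fin m → EuclideanSpace ℝ (Fin d) → ℝ} (hf : ∀ i, ConvexOn ℝ Set.univ (f i))
    (hdiff : ∀ i, Differentiable ℝ (f i)) {L G : ℝ} (hL0 : 0 ≤ L) (hG0 : 0 ≤ G)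
    (hLip : ∀ i x y, ‖gradient (f i) x - gradient (f i) y‖ ≤ L * ‖x - y‖)
    (hG : ∀ i, ∀ x ∈ C, ‖gradient (f i) x‖ ≤ G)
    {E : ℕ → Set (Fin m × Fin m)} {W : ℕ → Matrix (Fin m) (Fin m) ℝ} {α : ℕ → ℝ}
    (hself : ∀ k i, (i, i) ∈ E k) {Q : ℕ}
    (hconn : ∀ k, StronglyConnected (⋃ l ∈ Finset.range Q, E (k + l)))
    {η : ℝ} (hη : 0 < η) (hη1 : η < 1) (hlow : ∀ k i j, (i, j) ∈ E k → η ≤ W k i j)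
    (h0 : ∀ k i j, 0 ≤ W k i j) (h1 : ∀ k i, ∑ j, W k i j = 1)
    (hcol : ∀ k j, ∑ i, W k i j = 1)
    (hα : ∀ k, 0 < α k)
    (hα_sum : Tendsto (fun n => ∑ k ∈ Finset.range n, α k) atTop atTop)
    (hα_sq : Summable (fun k => α k ^ 2))
    (hopt : {x ∈ C | ∀ y ∈ C, ∑ i, f i x ≤ ∑ i, f i y}.Nonempty)
    {x : ℕ → Fin m → EuclideanSpace ℝ (Fin d)}
    (hx : ∀ k i, x (k + 1) i =
      proj (S k i) (mix (W k) (x k) i - α k • gradient (f i) (mix (W k) (x k) i)))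
    (hsum : ∀ i, Summable fun k => Metric.infDist (mix (W k) (x k) i) C ^ 2) :
    ∃ p ∈ {x ∈ C | ∀ y ∈ C, ∑ i, f i x ≤ ∑ i, f i y},
      ∀ i, Tendsto (fun k => x k i) atTop (𝓝 p) := by
  rcases isEmpty_or_nonempty (Fin m) with hm | ⟨⟨r⟩⟩
  · obtain ⟨p, hp⟩ := hopt
    exact ⟨p, hp, fun i => hm.elim i⟩
  obtain ⟨q, hqC, hqmin⟩ := hopt
  have hne : C.Nonempty := ⟨q, hqC⟩
  set D : Fin m → ℕ → ℝ := fun i k => Metric.infDist (mix (W k) (x k) i) C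
  have hD0 : ∀ i k, 0 ≤ D i k := fun i k => Metric.infDist_nonneg
  have hgsq : ∀ i, Summable fun k => (α k * (G + L * D i k)) ^ 2 := by
    intro i
    obtain ⟨B, hB⟩ := (hsum i).tendsto_zero_of_sq.bddAbove_range
    refine (hα_sq.sq_const_mul (G + L * B)).of_nonneg_of_le (fun k => sq_nonneg _) fun k => ?_
    have h2 : D i k ≤ B := hB ⟨k, rfl⟩
    have h3 : 0 ≤ G + L * D i k := by have := hD0 i k; positivity
    rw [mul_comm]
    refine pow_le_pow_left₀ (mul_nonneg h3 (hα k).le) (mul_le_mul_of_nonneg_right ?_ (hα k).le) 2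
    have := mul_le_mul_of_nonneg_left h2 hL0
    linarith
  -- the disagreement of the agents is square-summable
  set Δ : ℕ → ℝ := fun k => Metric.diam (Set.range (x k))
  have hΔ : Summable fun k => Δ k ^ 2 := by
    refine summable_diam_range_sq hη hη1 h0 h1 hlow hself hconn
      (e := fun k => ∑ i, (D i k + 2 * (α k * (G + L * D i k)))) (fun k i => ?_)
      (Summable.sq_sum _ fun i _ => (hsum i).sq_add ((hgsq i).sq_const_mul 2))
    rw [hx]
    refine (norm_step_sub_le hne hc (hSc k i) (hCS k i) (hα k).le (hLip i) (hG i) _).trans ?_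
    rw [mul_assoc]
    refine Finset.single_le_sum (f := fun i => D i k + 2 * (α k * (G + L * D i k)))
      (fun j _ => ?_) (Finset.mem_univ i)
    have := hD0 j k
    have := (hα k).le
    positivity
  -- feasible reference points, at a square-summable distance from all agents
  set u : ℕ → EuclideanSpace ℝ (Fin d) := fun k => proj C (mix (W k) (x k) r)
  have huC : ∀ k, u k ∈ C := fun k => proj_mem hne hc _
  set h : ℕ → ℝ := fun k => Δ k + D r k
  have hh0 : ∀ k, 0 ≤ h k := fun k => add_nonneg Metric.diam_nonneg (hD0 r k)
  have hhsq : Summable fun k => h k ^ 2 := hΔ.sq_add (hsum r)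
  have hhu : ∀ k y, (∀ j, ‖y - x k j‖ ≤ Δ k) → ‖y - u k‖ ≤ h k := by
    intro k y hy
    have h2 : ‖mix (W k) (x k) r - y‖ ≤ Δ k := by
      rw [mix_sub_const (h1 k)]
      calc ‖∑ j, W k r j • (x k j - y)‖ ≤ ∑ j, W k r j * Δ k := by
            refine norm_sum_le_of_le _ fun j _ => ?_
            rw [norm_smul, Real.norm_of_nonneg (h0 _ _ _), norm_sub_rev]
            exact mul_le_mul_of_nonneg_left (hy j) (h0 _ _ _)
        _ = Δ k := by rw [← Finset.sum_mul, h1, one_mul]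
    have h3 : D r k = ‖u k - mix (W k) (x k) r‖ := infDist_eq_norm_proj_sub hne hc _
    rw [← norm_neg, neg_sub]
    calc ‖u k - y‖ = ‖(mix (W k) (x k) r - y) + (u k - mix (W k) (x k) r)‖ := by congr 1; abel
      _ ≤ _ := (norm_add_le _ _).trans (add_le_add h2 h3.ge)
  have hxu : ∀ k i, ‖x k i - u k‖ ≤ h k := fun k i =>
    hhu k _ (norm_sub_le_diam_range (x k) i)
  have hvu : ∀ k i, ‖mix (W k) (x k) i - u k‖ ≤ h k := by
    intro k i
    rw [mix_sub_const (h1 k)]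
    calc ‖∑ j, W k i j • (x k j - u k)‖ ≤ ∑ j, W k i j * h k := by
          refine norm_sum_le_of_le _ fun j _ => ?_
          rw [norm_smul, Real.norm_of_nonneg (h0 _ _ _)]
          exact mul_le_mul_of_nonneg_left (hxu k j) (h0 _ _ _)
      _ = h k := by rw [← Finset.sum_mul, h1, one_mul]
  -- quasi-Fejér monotonicity with respect to every minimizer
  have hfejer : ∀ p ∈ {x ∈ C | ∀ y ∈ C, ∑ i, f i x ≤ ∑ i, f i y},
      (∃ l, Tendsto (fun k => ∑ i, ‖x k i - p‖ ^ 2) atTop (𝓝 l)) ∧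
      Summable fun k => 2 * α k * (∑ i, f i (u k) - ∑ i, f i p) := by
    rintro p ⟨hpC, hpmin⟩
    refine tendsto_and_summable_of_le_sub_add
      (b := fun k => ∑ i : Fin m, (2 * G * (α k * h k) + (α k * (G + L * D i k)) ^ 2))
      (fun k => by positivity)
      (fun k => ?_) (fun k => ?_) (summable_sum fun i _ => ?_) fun k => ?_
    · have := hh0 k
      have := (hα k).le
      positivity
    · have := hα k
      have := sub_nonneg.2 (hpmin _ (huC k))
      positivity
    · exact ((hα_sq.mul_of_sq hhsq).mul_left _).add (hgsq i)
    · have hmixle := sum_norm_mix_sub_sq_le (h0 k) (h1 k) (hcol k) (x k) p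
      have hstep : ∑ i, ‖x (k + 1) i - p‖ ^ 2 ≤ ∑ i, (‖mix (W k) (x k) i - p‖ ^ 2
          - 2 * α k * (f i (u k) - f i p)
          + (2 * G * (α k * h k) + (α k * (G + L * D i k)) ^ 2)) := by
        refine Finset.sum_le_sum fun i _ => ?_
        rw [hx]
        refine (norm_step_sub_sq_le (hf i) (hdiff i) hc (hSc k i) (hSconv k i) (hCS k i)
          (hα k).le (hLip i) (hG i) hpC (huC k) _).trans ?_
        have := mul_le_mul_of_nonneg_left (mul_le_mul_of_nonneg_left (hvu k i) (hα k).le)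
          (show 0 ≤ 2 * G by linarith)
        linarith
      rw [Finset.sum_add_distrib, Finset.sum_sub_distrib, ← Finset.mul_sum,
        Finset.sum_sub_distrib] at hstep
      linarith
  -- the reference points are bounded, and their values are infinitely often almost optimal
  have hh : Tendsto h atTop (𝓝 0) := hhsq.tendsto_zero_of_sq
  obtain ⟨⟨l, hl⟩, hvals⟩ := hfejer q ⟨hqC, hqmin⟩
  have hbdd : ∃ R, ∀ k, u k ∈ Metric.closedBall q R := by
    obtain ⟨B1, hB1⟩ := hl.bddAbove_range
    obtain ⟨B2, hB2⟩ := hh.bddAbove_range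
    refine ⟨B2 + (1 + B1), fun k => ?_⟩
    have h2 : ∑ i, ‖x k i - q‖ ^ 2 ≤ B1 := hB1 ⟨k, rfl⟩
    have h3 : ‖x k r - q‖ ^ 2 ≤ ∑ i, ‖x k i - q‖ ^ 2 :=
      Finset.single_le_sum (f := fun i => ‖x k i - q‖ ^ 2) (fun i _ => sq_nonneg _)
        (Finset.mem_univ r)
    have h4 : h k ≤ B2 := hB2 ⟨k, rfl⟩
    have h5 := hxu k r
    rw [norm_sub_rev] at h5
    have h6 : ‖u k - q‖ ≤ ‖u k - x k r‖ + ‖x k r - q‖ := norm_sub_le_norm_sub_add_norm_sub _ _ _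
    rw [mem_closedBall_iff_norm]
    nlinarith [sq_nonneg (‖x k r - q‖ - 1)]
  obtain ⟨R, hR⟩ := hbdd
  have hfreq : ∀ n : ℕ, ∃ᶠ k in atTop,
      ∑ i, f i (u k) - ∑ i, f i q < 1 / ((n : ℝ) + 1) := fun n =>
    frequently_lt_of_summable_mul (fun k => mul_pos two_pos (hα k))
      (by simpa [← Finset.mul_sum] using hα_sum.const_mul_atTop two_pos) hvals
      Nat.one_div_pos_of_nat
  obtain ⟨φ, hφ, hφlt⟩ := extraction_forall_of_frequently hfreq
  obtain ⟨p, -, ψ, hψ, hlim⟩ :=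
    tendsto_subseq_of_bounded Metric.isBounded_closedBall fun n => hR (φ n)
  have hsub : Tendsto (fun n => φ (ψ n)) atTop atTop := hφ.tendsto_atTop.comp hψ.tendsto_atTop
  have hpopt : p ∈ {x ∈ C | ∀ y ∈ C, ∑ i, f i x ≤ ∑ i, f i y} := by
    refine ⟨hc.mem_of_tendsto hlim (Eventually.of_forall fun n => huC _), fun y hy => ?_⟩
    refine le_trans ?_ (hqmin y hy)
    have hcont : Continuous fun z => ∑ i, f i z - ∑ i, f i q :=
      (continuous_finsetSum _ fun i _ => (hdiff i).continuous).sub continuous_const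
    have h2 := le_of_tendsto_of_tendsto' ((hcont.tendsto p).comp hlim)
      ((tendsto_one_div_add_atTop_nhds_zero_nat (𝕜 := ℝ)).comp hψ.tendsto_atTop)
      fun n => (hφlt (ψ n)).le
    linarith
  -- the distances to the cluster point `p` converge, and vanish along the subsequence
  refine ⟨p, hpopt, fun i => ?_⟩
  obtain ⟨⟨l', hl'⟩, -⟩ := hfejer p hpopt
  have hxsub : ∀ i, Tendsto (fun n => x (φ (ψ n)) i - p) atTop (𝓝 0) := by
    intro i
    have h2 : Tendsto (fun n => x (φ (ψ n)) i - u (φ (ψ n))) atTop (𝓝 0) :=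
      squeeze_zero_norm (fun n => hxu _ i) (hh.comp hsub)
    have h3 : Tendsto (fun n => u (φ (ψ n)) - p) atTop (𝓝 0) := by
      simpa using hlim.sub_const p
    simpa using h2.add h3
  have hl0 : l' = 0 := by
    refine tendsto_nhds_unique (hl'.comp hsub) ?_
    have h2 : Tendsto (fun n => ∑ i, ‖x (φ (ψ n)) i - p‖ ^ 2) atTop
        (𝓝 (∑ i : Fin m, ‖(0 : EuclideanSpace ℝ (Fin d))‖ ^ 2)) :=
      tendsto_finsetSum _ fun i _ => (hxsub i).norm.pow 2
    simpa [Function.comp_def] using h2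
  rw [hl0] at hl'
  have h2 : Tendsto (fun k => ‖x k i - p‖ ^ 2) atTop (𝓝 0) :=
    squeeze_zero (fun k => sq_nonneg _) (fun k => Finset.single_le_sum
      (f := fun i => ‖x k i - p‖ ^ 2) (fun i _ => sq_nonneg _) (Finset.mem_univ i)) hl'
  rw [tendsto_iff_norm_sub_tendsto_zero]
  simpa using h2.sqrt

/-! ### Expected distances to the feasible set -/

theorem summable_iff_tsum_ofReal_lt_top {F : ℕ → ℝ} (hF : ∀ k, 0 ≤ F k) :
    Summable F ↔ ∑' k, ENNReal.ofReal (F k) < ⊤ := by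
  refine ⟨fun h => h.tsum_ofReal_lt_top, fun h => ?_⟩
  refine (ENNReal.summable_toReal h.ne).congr fun k => ?_
  rw [ENNReal.toReal_ofReal (hF k)]

theorem ae_summable_of_summable_integral {Ω : Type*} [MeasurableSpace Ω] {μ : Measure Ω}
    {F : ℕ → Ω → ℝ} (hF : ∀ k ω, 0 ≤ F k ω) (hint : ∀ k, Integrable (F k) μ)
    (hsum : Summable fun k => ∫ ω, F k ω ∂μ) : ∀ᵐ ω ∂μ, Summable fun k => F k ω := by
  have hmeas : ∀ k, AEMeasurable (fun ω => ENNReal.ofReal (F k ω)) μ :=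
    fun k => (hint k).aemeasurable.ennreal_ofReal
  have hfin : ∫⁻ ω, ∑' k, ENNReal.ofReal (F k ω) ∂μ ≠ ⊤ := by
    rw [lintegral_tsum hmeas]
    simp only [← ofReal_integral_eq_lintegral_ofReal (hint _) (ae_of_all _ (hF _))]
    exact hsum.tsum_ofReal_ne_top
  filter_upwards [ae_lt_top' (AEMeasurable.tsum hmeas) hfin] with ω hω
  exact (summable_iff_tsum_ofReal_lt_top fun k => hF k ω).2 hω

/-- Averaging over the second of two independent finitely valued random variables first. -/
theorem integral_le_integral_of_indepFun {Ω A B : Type*} [MeasurableSpace Ω] {μ : Measure Ω}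
    [IsProbabilityMeasure μ] [Finite A] [Finite B] [MeasurableSpace A] [MeasurableSpace B]
    [DiscreteMeasurableSpace A] [DiscreteMeasurableSpace B] {T : Ω → A} {Y : Ω → B}
    (hT : Measurable T) (hY : Measurable Y) (hind : IndepFun T Y μ) {H : A → ℝ} {h : A → B → ℝ}
    (hle : ∀ a, H a ≤ ∫ ω, h a (Y ω) ∂μ) :
    ∫ ω, H (T ω) ∂μ ≤ ∫ ω, h (T ω) (Y ω) ∂μ := by
  have := Measure.isProbabilityMeasure_map (μ := μ) hT.aemeasurable
  have := Measure.isProbabilityMeasure_map (μ := μ) hY.aemeasurable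
  have hprod := (indepFun_iff_map_prod_eq_prod_map_map hT.aemeasurable hY.aemeasurable).1 hind
  have h1 : ∫ ω, h (T ω) (Y ω) ∂μ = ∫ a, ∫ b, h a b ∂(μ.map Y) ∂(μ.map T) := by
    rw [← integral_prod (fun z : A × B => h z.1 z.2) Integrable.of_finite, ← hprod,
      integral_map (hT.prodMk hY).aemeasurable
        (Measurable.of_discrete (f := fun z : A × B => h z.1 z.2)).aestronglyMeasurable]
  rw [h1, ← integral_map hT.aemeasurable (Measurable.of_discrete (f := H)).aestronglyMeasurable]
  refine integral_mono Integrable.of_finite Integrable.of_finite fun a => ?_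
  rw [integral_map hY.aemeasurable (Measurable.of_discrete (f := h a)).aestronglyMeasurable]
  exact hle a

section Random

variable {d m : ℕ} {I : Fin m → Type*} {X : (i : Fin m) → I i → Set (EuclideanSpace ℝ (Fin d))}
  {f : Fin m → EuclideanSpace ℝ (Fin d) → ℝ} {W : ℕ → Matrix (Fin m) (Fin m) ℝ} {α : ℕ → ℝ}

theorem drp_congr {x₀ : Fin m → EuclideanSpace ℝ (Fin d)} {s s' : ℕ → (i : Fin m) → I i} {k : ℕ}
    (h : ∀ l < k, s l = s' l) : drp X f W α x₀ s k = drp X f W α x₀ s' k := by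
  induction k with
  | zero => rfl
  | succ k ih => simp only [drp, ih fun l hl => h l (by omega), h k (by omega)]

theorem isClosed_feasibleSet (hclosed : ∀ i j, IsClosed (X i j)) : IsClosed (feasibleSet X) :=
  isClosed_iInter fun i => isClosed_iInter fun j => hclosed i j

theorem convex_feasibleSet (hconvex : ∀ i j, Convex ℝ (X i j)) : Convex ℝ (feasibleSet X) :=
  convex_iInter fun i => convex_iInter fun j => hconvex i j

theorem feasibleSet_subset (i : Fin m) (j : I i) : feasibleSet X ⊆ X i j :=
  Set.iInter_subset_of_subset i (Set.iInter_subset _ j)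

variable [∀ i, Finite (I i)] [∀ i, MeasurableSpace (I i)] [∀ i, DiscreteMeasurableSpace (I i)]

theorem measurable_drp (hclosed : ∀ i j, IsClosed (X i j)) (hconvex : ∀ i j, Convex ℝ (X i j))
    (hne : (feasibleSet X).Nonempty) (hgrad : ∀ i, Continuous (gradient (f i))) (k : ℕ)
    (i : Fin m) :
    Measurable fun p : (Fin m → EuclideanSpace ℝ (Fin d)) × (ℕ → (i : Fin m) → I i) =>
      drp X f W α p.1 p.2 k i := by
  induction k generalizing i with
  | zero => exact (measurable_pi_apply i).comp measurable_fst
  | succ k ih =>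
    have hmix : Measurable fun p : (Fin m → EuclideanSpace ℝ (Fin d)) × (ℕ → (i : Fin m) → I i) =>
        mix (W k) (drp X f W α p.1 p.2 k) i :=
      Finset.measurable_sum _ fun j _ => (ih j).fun_const_smul _
    have hidx : Measurable fun p : (Fin m → EuclideanSpace ℝ (Fin d)) × (ℕ → (i : Fin m) → I i) =>
        p.2 k i :=
      (measurable_pi_apply i).comp ((measurable_pi_apply k).comp measurable_snd)
    have hproj : Measurable fun q : EuclideanSpace ℝ (Fin d) × I i => proj (X i q.2) q.1 :=
      measurable_from_prod_countable_left fun j =>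
        (continuous_proj (hne.mono (feasibleSet_subset i j)) (hclosed i j)
          (hconvex i j)).measurable
    exact hproj.comp
      ((hmix.sub (((hgrad i).measurable.comp hmix).fun_const_smul (α k))).prodMk hidx)

variable {Ω : Type*} [MeasurableSpace Ω] {μ : Measure Ω} [IsProbabilityMeasure μ]
  {idx : (i : Fin m) → ℕ → Ω → I i}

/-- For deterministic initial points, the squared distances of the mixed iterates to the feasible
set are almost surely summable, because their expectations are: regularity turns the decrease from
the random projections into one proportional to the distance, which absorbs the first-order errors
of the gradient steps. -/
theorem ae_summable_infDist_sq (hidx : ∀ i k, Measurable (idx i k))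
    (hclosed : ∀ i j, IsClosed (X i j)) (hconvex : ∀ i j, Convex ℝ (X i j))
    (hne : (feasibleSet X).Nonempty)
    (hf : ∀ i, ConvexOn ℝ Set.univ (f i)) (hdiff : ∀ i, Differentiable ℝ (f i)) {L G : ℝ}
    (hLip : ∀ i x y, ‖gradient (f i) x - gradient (f i) y‖ ≤ L * ‖x - y‖)
    (hG : ∀ i, ∀ x ∈ feasibleSet X, ‖gradient (f i) x‖ ≤ G)
    (hindep : iIndepFun (fun (k : ℕ) (ω : Ω) (i : Fin m) => idx i k ω) μ)
    {c : ℝ} (hc : 0 < c)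
    (hreg : ∀ i k x, Metric.infDist x (feasibleSet X) ^ 2 ≤
        c * ∫ ω, Metric.infDist x (X i (idx i k ω)) ^ 2 ∂μ)
    (h0 : ∀ k i j, 0 ≤ W k i j) (h1 : ∀ k i, ∑ j, W k i j = 1)
    (hcol : ∀ k j, ∑ i, W k i j = 1)
    (hα : ∀ k, 0 < α k) (hα_sq : Summable (fun k => α k ^ 2))
    (x₀ : Fin m → EuclideanSpace ℝ (Fin d)) :
    ∀ᵐ ω ∂μ, ∀ i, Summable fun k => Metric.infDist
      (mix (W k) (drp X f W α x₀ (fun k i => idx i k ω) k) i) (feasibleSet X) ^ 2 := by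
  set C := feasibleSet X
  have hCc : IsClosed C := isClosed_feasibleSet hclosed
  have hCconv : Convex ℝ C := convex_feasibleSet hconvex
  obtain ⟨ω₀⟩ : Nonempty Ω := μ.nonempty_of_neZero
  -- the iterates up to time `k` are functions of the finitely valued tuple `T k`
  let T : (k : ℕ) → Ω → (Finset.range k → (i : Fin m) → I i) := fun k ω l i => idx i l ω
  let ext : (k : ℕ) → (Finset.range k → (i : Fin m) → I i) → ℕ → (i : Fin m) → I i :=
    fun k t l => if h : l ∈ Finset.range k then t ⟨l, h⟩ else fun i => idx i l ω₀
  let x : (k : ℕ) → (Finset.range k → (i : Fin m) → I i) → Fin m → EuclideanSpace ℝ (Fin d) :=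
    fun k t => drp X f W α x₀ (ext k t) k
  have hTmeas : ∀ k, Measurable (T k) := fun k =>
    measurable_pi_lambda _ fun l => measurable_pi_lambda _ fun i => hidx i l
  have hYmeas : ∀ k, Measurable fun (ω : Ω) (i : Fin m) => idx i k ω := fun k =>
    measurable_pi_lambda _ fun i => hidx i k
  have hxT : ∀ k ω, drp X f W α x₀ (fun k i => idx i k ω) k = x k (T k ω) := fun k ω =>
    drp_congr fun l hl => by simp [ext, T, hl]
  have hint : ∀ k (F : (Finset.range k → (i : Fin m) → I i) → ℝ),
      Integrable (fun ω => F (T k ω)) μ := fun k F =>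
    (Integrable.of_finite (μ := μ.map (T k))).comp_measurable (hTmeas k)
  have hTY : ∀ k, IndepFun (T k) (fun ω i => idx i k ω) μ := by
    intro k
    have h := hindep.indepFun_finset (Finset.range k) {k} (by simp) hYmeas
    exact h.comp (φ := id)
      (ψ := fun y : ({k} : Finset ℕ) → (i : Fin m) → I i => y ⟨k, Finset.mem_singleton_self k⟩)
      measurable_id (measurable_pi_apply _)
  simp only [hxT]
  set D : (k : ℕ) → Fin m → Ω → ℝ := fun k i ω => Metric.infDist (mix (W k) (x k (T k ω)) i) C ^ 2
  set DS : (k : ℕ) → Fin m → Ω → ℝ := fun k i ω =>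
    Metric.infDist (mix (W k) (x k (T k ω)) i) (X i (idx i k ω)) ^ 2
  have hDint : ∀ k i, Integrable (D k i) μ := fun k i =>
    hint k fun t => Metric.infDist (mix (W k) (x k t) i) C ^ 2
  have hDSint : ∀ k i, Integrable (DS k i) μ := fun k i =>
    (Integrable.of_finite (μ := μ.map fun ω => (T k ω, fun i => idx i k ω))
      (f := fun z : _ × ((i : Fin m) → I i) =>
        Metric.infDist (mix (W k) (x k z.1) i) (X i (z.2 i)) ^ 2)).comp_measurable
      ((hTmeas k).prodMk (hYmeas k))
  have hDS : ∀ k i, ∫ ω, D k i ω ∂μ ≤ c * ∫ ω, DS k i ω ∂μ := by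
    intro k i
    rw [← integral_const_mul]
    refine integral_le_integral_of_indepFun (hTmeas k) (hYmeas k) (hTY k)
      (H := fun t => Metric.infDist (mix (W k) (x k t) i) C ^ 2)
      (h := fun t y => c * Metric.infDist (mix (W k) (x k t) i) (X i (y i)) ^ 2) fun t => ?_
    rw [integral_const_mul]
    exact hreg i k _
  set a : ℕ → ℝ := fun k => ∑ i, ∫ ω, Metric.infDist (x k (T k ω) i) C ^ 2 ∂μ
  set b : ℕ → ℝ := fun k => ∑ i, ∫ ω, D k i ω ∂μ
  have hb0 : ∀ k, 0 ≤ b k := fun k =>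
    Finset.sum_nonneg fun i _ => integral_nonneg fun ω => sq_nonneg _
  have hba : ∀ k, b k ≤ a k := by
    intro k
    simp only [a, b]
    rw [← integral_finsetSum _ fun i _ => hDint k i, ← integral_finsetSum _ fun i _ =>
      hint k fun t => Metric.infDist (x k t i) C ^ 2]
    exact integral_mono (integrable_finsetSum _ fun i _ => hDint k i)
      (integrable_finsetSum _ fun i _ => hint k fun t => Metric.infDist (x k t i) C ^ 2)
      fun ω => sum_infDist_mix_sq_le (h0 k) (h1 k) (hcol k) hne hCc hCconv _
  -- the Young parameter `1 / (4 c)` costs half of what the projections gain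
  set τ : ℝ := 1 / (4 * c)
  have hτ : 0 < τ := by positivity
  set K : ℝ := (4 + 1 / τ) * G ^ 2
  have hK : 0 ≤ K := by positivity
  have hrec : ∀ k, a (k + 1) ≤ (1 - τ + 4 * L ^ 2 * α k ^ 2) * b k + m * K * α k ^ 2 := by
    intro k
    have hterm : ∀ i, ∫ ω, Metric.infDist (x (k + 1) (T (k + 1) ω) i) C ^ 2 ∂μ ≤
        (1 - τ + 4 * L ^ 2 * α k ^ 2) * ∫ ω, D k i ω ∂μ + K * α k ^ 2 := by
      intro i
      have hI1 := (hDint k i).const_mul (1 + τ + 4 * L ^ 2 * α k ^ 2)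
      have hI2 := (hDSint k i).const_mul (1 / 2)
      have hI3 : Integrable (fun ω => (1 + τ + 4 * L ^ 2 * α k ^ 2) * D k i ω
          - 1 / 2 * DS k i ω) μ := hI1.sub hI2
      have hmono : ∫ ω, Metric.infDist (x (k + 1) (T (k + 1) ω) i) C ^ 2 ∂μ ≤
          ∫ ω, ((1 + τ + 4 * L ^ 2 * α k ^ 2) * D k i ω - 1 / 2 * DS k i ω
            + K * α k ^ 2) ∂μ := by
        refine integral_mono (hint (k + 1) fun t => Metric.infDist (x (k + 1) t i) C ^ 2)
          (hI3.add (integrable_const _)) fun ω => ?_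
        simp only
        rw [← hxT, drp]
        simp only [hxT]
        exact infDist_step_sq_le (hf i) (hdiff i) hne hCc (hclosed _ _) (hconvex _ _)
          (feasibleSet_subset _ _) (hα k).le (hLip i) (hG i) hτ _
      rw [integral_add hI3 (integrable_const _), integral_sub hI1 hI2,
        integral_const_mul, integral_const_mul, integral_const, probReal_univ, one_smul] at hmono
      have h2 : 2 * τ * ∫ ω, D k i ω ∂μ ≤ 1 / 2 * ∫ ω, DS k i ω ∂μ := by
        have h3 := mul_le_mul_of_nonneg_left (hDS k i) (show 0 ≤ 2 * τ by linarith)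
        have h4 : 2 * τ * (c * ∫ ω, DS k i ω ∂μ) = 1 / 2 * ∫ ω, DS k i ω ∂μ := by
          simp only [τ]
          field_simp
          norm_num
        linarith
      linarith
    refine (Finset.sum_le_sum fun i _ => hterm i).trans_eq ?_
    rw [Finset.sum_add_distrib, ← Finset.mul_sum]
    simp [b]
    ring
  -- for late times the factor of `b k` is at most `1 - τ / 2`
  have hsmall : ∀ᶠ k in atTop, 4 * L ^ 2 * α k ^ 2 < τ / 2 := by
    have h2 := (hα_sq.mul_left (4 * L ^ 2)).tendsto_atTop_zero
    exact h2.eventually_lt_const (half_pos hτ)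
  obtain ⟨N, hN⟩ := eventually_atTop.1 hsmall
  have hbsum : Summable fun k => τ / 2 * b (k + N) := by
    refine (tendsto_and_summable_of_le_sub_add (a := fun k => a (k + N))
      (b := fun k => m * K * α (k + N) ^ 2) (fun k => (hb0 _).trans (hba _))
      (fun k => by positivity) (fun k => mul_nonneg (half_pos hτ).le (hb0 _))
      (((summable_nat_add_iff N).2 hα_sq).mul_left _) fun k => ?_).2
    have h2 := hrec (k + N)
    rw [add_right_comm]
    have h3 := mul_le_mul_of_nonneg_right (hN (k + N) (by omega)).le (hb0 (k + N))
    have h4 := hba (k + N)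
    linarith
  have hb : Summable b :=
    (summable_nat_add_iff N).1 ((summable_mul_left_iff (half_pos hτ).ne').1 hbsum)
  rw [ae_all_iff]
  intro i
  refine ae_summable_of_summable_integral (F := fun k => D k i) (fun k ω => sq_nonneg _)
    (fun k => hDint k i) (hb.of_nonneg_of_le (fun k => integral_nonneg fun ω => sq_nonneg _)
      fun k => ?_)
  exact Finset.single_le_sum (f := fun i => ∫ ω, D k i ω ∂μ)
    (fun i _ => integral_nonneg fun ω => sq_nonneg _) (Finset.mem_univ i)

end Random

/-! ### Almost sure convergence -/

theorem isClosed_optimalSet {d m : ℕ} {I : Fin m → Type*}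
    {X : (i : Fin m) → I i → Set (EuclideanSpace ℝ (Fin d))}
    {f : Fin m → EuclideanSpace ℝ (Fin d) → ℝ} (hclosed : ∀ i j, IsClosed (X i j))
    (hf : ∀ i, Continuous (f i)) : IsClosed (optimalSet X f) := by
  have h : optimalSet X f = feasibleSet X ∩
      ⋂ y ∈ feasibleSet X, {x | ∑ i, f i x ≤ ∑ i, f i y} := by
    ext x
    simp [optimalSet]
  rw [h]
  exact (isClosed_feasibleSet hclosed).inter <| isClosed_biInter fun y _ =>
    isClosed_le (continuous_finsetSum _ fun i _ => hf i) continuous_const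

theorem proposition1
    {d m : ℕ}
    -- component sets `X i j`, for `j` in the finite index set `I i` of agent `i`
    {I : Fin m → Type*} [∀ i, Finite (I i)]
    [∀ i, MeasurableSpace (I i)] [∀ i, DiscreteMeasurableSpace (I i)]
    (X : (i : Fin m) → I i → Set (EuclideanSpace ℝ (Fin d)))
    (f : Fin m → EuclideanSpace ℝ (Fin d) → ℝ)
    -- network: `(i, j) ∈ E k` when agent `i` receives information from agent `j` at time `k`
    (E : ℕ → Set (Fin m × Fin m)) (W : ℕ → Matrix (Fin m) (Fin m) ℝ) (α : ℕ → ℝ)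
    -- random initial points and random constraint indices
    {Ω : Type*} [MeasurableSpace Ω] (μ : Measure Ω) [IsProbabilityMeasure μ]
    (x₀ : Fin m → Ω → EuclideanSpace ℝ (Fin d)) (idx : (i : Fin m) → ℕ → Ω → I i)
    (hx₀ : ∀ i, Measurable (x₀ i)) (hidx : ∀ i k, Measurable (idx i k))
    -- closed convex component sets; convex objectives; Lipschitz gradients; bounded on the
    -- feasible set
    (hclosed : ∀ i j, IsClosed (X i j)) (hconvex : ∀ i j, Convex ℝ (X i j))
    (hf : ∀ i, ConvexOn ℝ Set.univ (f i)) (hdiff : ∀ i, Differentiable ℝ (f i))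
    (hLip : ∃ L : ℝ, ∀ i x y, ‖gradient (f i) x - gradient (f i) y‖ ≤ L * ‖x - y‖)
    (hbdd : ∃ G : ℝ, ∀ i, ∀ x ∈ feasibleSet X, ‖gradient (f i) x‖ ≤ G)
    -- random indices: independent over time, identically distributed over time for each agent,
    -- independent of the initial points, each index having positive probability
    (hindep : iIndepFun (fun (k : ℕ) (ω : Ω) (i : Fin m) => idx i k ω) μ)
    (hident : ∀ i k, IdentDistrib (idx i k) (idx i 0) μ μ)
    (hinit : IndepFun (fun (ω : Ω) (i : Fin m) => x₀ i ω)
      (fun (ω : Ω) (k : ℕ) (i : Fin m) => idx i k ω) μ)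
    (hpos : ∀ i k (j : I i), 0 < μ {ω | idx i k ω = j})
    -- linear regularity in expectation
    (hreg : ∀ i, ∃ c : ℝ, 0 < c ∧ ∀ k x,
      Metric.infDist x (feasibleSet X) ^ 2 ≤
        c * ∫ ω, Metric.infDist x (X i (idx i k ω)) ^ 2 ∂μ)
    -- network connectivity
    (hself : ∀ k i, (i, i) ∈ E k)
    (hconn : ∃ Q : ℕ, ∀ k, StronglyConnected (⋃ l ∈ Finset.range Q, E (k + l)))
    -- doubly stochastic weights
    (hW_nonneg : ∀ k i j, 0 ≤ W k i j)
    (hW_zero : ∀ k i j, (i, j) ∉ E k → W k i j = 0)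
    (hW_row : ∀ k i, ∑ j, W k i j = 1)
    (hW_lower : ∃ η : ℝ, 0 < η ∧ η < 1 ∧ ∀ k i j, (i, j) ∈ E k → η ≤ W k i j)
    (hW_col : ∀ k j, ∑ i, W k i j = 1)
    -- stepsizes
    (hα_pos : ∀ k, 0 < α k)
    (hα_sum : Tendsto (fun n => ∑ k ∈ Finset.range n, α k) atTop atTop)
    (hα_sq : Summable (fun k => α k ^ 2))
    -- existence of an optimal point
    (hopt : (optimalSet X f).Nonempty) :
    ∃ xstar : Ω → EuclideanSpace ℝ (Fin d), Measurable xstar ∧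
      (∀ ω, xstar ω ∈ optimalSet X f) ∧
      ∀ᵐ ω ∂μ, ∀ i, Tendsto
        (fun k => drp X f W α (fun i => x₀ i ω) (fun k i => idx i k ω) k i)
        atTop (𝓝 (xstar ω)) := by
  obtain ⟨L, hL⟩ := hLip
  obtain ⟨G, hG⟩ := hbdd
  obtain ⟨Q, hQ⟩ := hconn
  obtain ⟨η, hη, hη1, hlow⟩ := hW_lower
  choose c hc hcreg using hreg
  have hLip' : ∀ i x y, ‖gradient (f i) x - gradient (f i) y‖ ≤ |L| * ‖x - y‖ := fun i x y =>
    (hL i x y).trans (mul_le_mul_of_nonneg_right (le_abs_self L) (norm_nonneg _))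
  have hG' : ∀ i, ∀ x ∈ feasibleSet X, ‖gradient (f i) x‖ ≤ |G| := fun i x hx =>
    (hG i x hx).trans (le_abs_self G)
  have hgrad : ∀ i, Continuous (gradient (f i)) := fun i =>
    (LipschitzWith.of_dist_le_mul (K := Real.nnabs L) fun x y => by
      simpa only [dist_eq_norm, Real.coe_nnabs] using hLip' i x y).continuous
  have hne : (feasibleSet X).Nonempty := hopt.mono fun x hx => hx.1
  -- one regularity constant for all agents; the summand `1` makes it positive even for `m = 0`
  have hcsum : ∀ i, c i ≤ 1 + ∑ i, c i := fun i => by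
    have := Finset.single_le_sum (f := c) (fun i _ => (hc i).le) (Finset.mem_univ i)
    linarith
  have hcpos : 0 < 1 + ∑ i, c i := by
    have := Finset.sum_nonneg fun i (_ : i ∈ Finset.univ) => (hc i).le
    linarith
  have hcreg' : ∀ i k x, Metric.infDist x (feasibleSet X) ^ 2 ≤
      (1 + ∑ i, c i) * ∫ ω, Metric.infDist x (X i (idx i k ω)) ^ 2 ∂μ := fun i k x =>
    (hcreg i k x).trans (mul_le_mul_of_nonneg_right (hcsum i)
      (integral_nonneg fun ω => sq_nonneg _))
  have hx₀' : Measurable fun (ω : Ω) (i : Fin m) => x₀ i ω := measurable_pi_lambda _ hx₀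
  have hidx' : Measurable fun (ω : Ω) (k : ℕ) (i : Fin m) => idx i k ω :=
    measurable_pi_lambda _ fun k => measurable_pi_lambda _ fun i => hidx i k
  have hdrp := measurable_drp (f := f) (W := W) (α := α) hclosed hconvex hne hgrad
  -- by independence of the initial points, it is enough to treat deterministic ones
  have hsum : ∀ᵐ ω ∂μ, ∀ i, Summable fun k => Metric.infDist
      (mix (W k) (drp X f W α (fun i => x₀ i ω) (fun k i => idx i k ω) k) i)
      (feasibleSet X) ^ 2 := by
    let P : (Fin m → EuclideanSpace ℝ (Fin d)) × (ℕ → (i : Fin m) → I i) → Prop := fun p =>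
      ∀ i, Summable fun k => Metric.infDist (mix (W k) (drp X f W α p.1 p.2 k) i)
        (feasibleSet X) ^ 2
    have hP : MeasurableSet {p | P p} := by
      simp only [P, summable_iff_tsum_ofReal_lt_top fun k => sq_nonneg _, Set.ofPred_forall]
      refine MeasurableSet.iInter fun i => measurableSet_lt (Measurable.tsum fun k => ?_)
        measurable_const
      have hmix : Measurable fun p : (Fin m → EuclideanSpace ℝ (Fin d)) ×
          (ℕ → (i : Fin m) → I i) => mix (W k) (drp X f W α p.1 p.2 k) i :=
        Finset.measurable_sum _ fun j _ => (hdrp k j).fun_const_smul _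
      exact (hmix.infDist.pow_const 2).ennreal_ofReal
    have hpair := (indepFun_iff_map_prod_eq_prod_map_map hx₀'.aemeasurable
      hidx'.aemeasurable).1 hinit
    have := Measure.isProbabilityMeasure_map (μ := μ) hidx'.aemeasurable
    have hae : ∀ᵐ p ∂(μ.map fun ω => ((fun i => x₀ i ω), fun k i => idx i k ω)), P p := by
      rw [hpair, Measure.ae_prod_iff_ae_ae hP]
      refine ae_of_all _ fun y => ?_
      refine (ae_map_iff hidx'.aemeasurable (p := fun s => P (y, s))
        (measurable_prodMk_left hP)).2 ?_
      exact ae_summable_infDist_sq hidx hclosed hconvex hne hf hdiff hLip' hG' hindep hcpos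
        hcreg' hW_nonneg hW_row hW_col hα_pos hα_sq y
    exact (ae_map_iff (hx₀'.prodMk hidx').aemeasurable hP).1 hae
  have hconv : ∀ᵐ ω ∂μ, ∃ p ∈ optimalSet X f, ∀ i, Tendsto
      (fun k => drp X f W α (fun i => x₀ i ω) (fun k i => idx i k ω) k i) atTop (𝓝 p) := by
    filter_upwards [hsum] with ω hω
    exact exists_tendsto_of_summable_infDist_sq (isClosed_feasibleSet hclosed)
      (S := fun k i => X i (idx i k ω)) (fun k i => hclosed i _) (fun k i => hconvex i _)
      (fun k i => feasibleSet_subset i _) hf hdiff (abs_nonneg L) (abs_nonneg G) hLip' hG'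
      hself hQ hη hη1 hlow hW_nonneg hW_row hW_col hα_pos hα_sum hα_sq hopt (fun k i => rfl) hω
  obtain ⟨q, hq⟩ := hopt
  rcases isEmpty_or_nonempty (Fin m) with hm | ⟨⟨r⟩⟩
  · exact ⟨fun _ => q, measurable_const, fun _ => hq, ae_of_all _ fun ω i => hm.elim i⟩
  obtain ⟨y, hy, hylim⟩ := measurable_limit_of_tendsto_metrizable_ae (μ := μ) (L := atTop)
    (f := fun k ω => drp X f W α (fun i => x₀ i ω) (fun k i => idx i k ω) k r)
    (fun k => ((hdrp k r).comp (hx₀'.prodMk hidx')).aemeasurable)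
    (hconv.mono fun ω ⟨p, _, hp⟩ => ⟨p, hp r⟩)
  -- redefine the limit on a null set, so that all of its values are optimal
  classical
  have hopt_meas : MeasurableSet (optimalSet X f) :=
    (isClosed_optimalSet hclosed fun i => (hdiff i).continuous).measurableSet
  refine ⟨fun ω => if y ω ∈ optimalSet X f then y ω else q,
    Measurable.ite (hy hopt_meas) hy measurable_const, fun ω => ?_, ?_⟩
  · simp only
    split_ifs with h
    exacts [h, hq]
  · filter_upwards [hconv, hylim] with ω ⟨p, hpopt, hp⟩ hyω i
    rw [tendsto_nhds_unique hyω (hp r), if_pos hpopt]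
    exact hp i
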